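/- Let $\mathbb{H}$ be the quaternions, $\mathbb{S}=\{I\in\mathbb{H} : I^2=-1\}$, and for $I\in\mathbb{S}$ let $\mathbb{C}_I=\mathbb{R}+\mathbb{R}I$, with Lebesgue measure $d\lambda_I(x+Iy)=dx\,dy$. Let $L^2(\mathbb{C}_I;e^{-|q|^2}d\lambda_I)$ be the right quaternionic Hilbert space of (classes of) $\mathbb{H}$-valued functions on $\mathbb{C}_I$ that are square integrable for $e^{-|q|^2}d\lambda_I$, with inner product $\langle f,g\rangle_{\mathbb{C}_I}=\int_{\mathbb{C}_I}\overline{f(q)}\,g(q)\,e^{-|q|^2}d\lambda_I(q)$. For $m,n\ge 0$ put $$H^Q_{m,n}(q,\overline q)=m!\,n!\sum_{j=0}^{\min(m,n)}\frac{(-1)^j}{j!}\,\frac{q^{m-j}\,\overline q^{\,n-j}}{(m-j)!\,(n-j)!},$$ and for $k=0,1,2,\dots$ let $\mathcal{SR}^2_{2,k}$ (the S-polyregular Bargmann space of second kind and level $k$) be the right quaternionic vector space of all functions on $\mathbb{H}$ of the form $$f(q)=\sum_{j=0}^{\infty}H^Q_{j,k}(q,\overline q)\,c_j,\qquad c_j\in\mathbb{H},\quad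 \sum_{j=0}^\infty j!\,|c_j|^2<\infty,$$ the first series converging unconditionally at every $q\in\mathbb{H}$. **Theorem.** For every $I\in\mathbb{S}$, $$L^2(\mathbb{C}_I;e^{-|q|^2}d\lambda_I)=\bigoplus_{k=0}^{+\infty}\mathcal{SR}^2_{2,k}$$ as an orthogonal Hilbert direct sum. Explicitly: for each $k$, restriction $f\mapsto f|_{\mathbb{C}_I}$ maps $\mathcal{SR}^2_{2,k}$ into $L^2(\mathbb{C}_I;e^{-|q|^2}d\lambda_I)$ and is injective (even modulo equality almost everywhere on $\mathbb{C}_I$), and, with $\mathcal{SR}^2_{2,k}$ identified with its image, 1. each $\mathcal{SR}^2_{2,k}$ is a closed right quaternionic subspace; 2. $\langle f,g\rangle_{\mathbb{C}_I}=0$ whenever $f\in\mathcal{SR}^2_{2,k}$, $g\in\mathcal{SR}^2_{2,l}$ and $k\ne l$; 3. every $f\in L^2(\mathbb{C}_I;e^{-|q|^2}d\lambda_I)$ can be written in exactly one way as $f=\sum_{k=0}^\infty g_k$ with $g_k\in\mathcal{SR}^2_{2,k}$, the series converging unconditionally in $L^2$-norm. -/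

import Mathlib

open MeasureTheory Quaternion
open scoped ENNReal

noncomputable section

namespace SPolyBargmann

instance instMeasurableSpaceQuaternion : MeasurableSpace ℍ[ℝ] := borel ℍ[ℝ]

instance instBorelSpaceQuaternion : BorelSpace ℍ[ℝ] := ⟨rfl⟩

/-- The sphere `𝕊` of imaginary units: the quaternions with square `-1`. -/
def imaginaryUnits : Set ℍ[ℝ] := {q | q ^ 2 = -1}

/-- The point `x + I y` with real coordinates `(x, y)`. -/
def slicePoint (I : ℍ[ℝ]) (p : ℝ × ℝ) : ℍ[ℝ] := (p.1 : ℍ[ℝ]) + I * (p.2 : ℍ[ℝ])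

/-- The slice `ℂ_I = ℝ + ℝ I`. -/
def slice (I : ℍ[ℝ]) : Set ℍ[ℝ] := Set.range (slicePoint I)

/-- Lebesgue measure `dλ_I = dx dy` on the slice `ℂ_I`. -/
def sliceLebesgue (I : ℍ[ℝ]) : Measure (slice I) :=
  (volume : Measure (ℝ × ℝ)).map (Set.rangeFactorization (slicePoint I))

/-- The Gaussian measure `e^{-|q|²} dλ_I` on the slice `ℂ_I`. -/
def sliceGaussian (I : ℍ[ℝ]) : Measure (slice I) :=
  (sliceLebesgue I).withDensity fun q => ENNReal.ofReal (Real.exp (-‖(q : ℍ[ℝ])‖ ^ 2))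

/-- The right quaternionic Hilbert space `L²(ℂ_I; e^{-|q|²} dλ_I)` of `ℍ`-valued functions. -/
abbrev SliceL2 (I : ℍ[ℝ]) := Lp ℍ[ℝ] 2 (sliceGaussian I)

/-- The quaternion-valued inner product `⟨f, g⟩ = ∫ conj(f) g e^{-|q|²} dλ_I`. -/
def sliceInner (I : ℍ[ℝ]) (F G : SliceL2 I) : ℍ[ℝ] :=
  ∫ q, star (F q) * G q ∂(sliceGaussian I)

/-- The quaternionic Hermite polynomial
`H_{m,n}(q, q̄) = m! n! ∑_{j ≤ min(m,n)} (-1)^j / j! * q^{m-j} q̄^{n-j} / ((m-j)! (n-j)!)`. -/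
def hermiteQ (m n : ℕ) (q : ℍ[ℝ]) : ℍ[ℝ] :=
  ((m.factorial : ℝ) * (n.factorial : ℝ)) • ∑ j ∈ Finset.range (min m n + 1),
    (((-1 : ℝ) ^ j / (j.factorial : ℝ)) /
        (((m - j).factorial : ℝ) * ((n - j).factorial : ℝ))) •
      (q ^ (m - j) * star q ^ (n - j))

/-- The S-polyregular Bargmann space of second kind and level `k`: the right quaternionic
vector space of the functions `f(q) = ∑_j H_{j,k}(q, q̄) c_j` on `ℍ` with quaternionic
coefficients such that `∑_j j! |c_j|² < ∞`. -/
def bargmann (k : ℕ) : Submodule ℍ[ℝ]ᵐᵒᵖ (ℍ[ℝ] → ℍ[ℝ]) where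
  carrier := {f | ∃ c : ℕ → ℍ[ℝ], Summable (fun j => (j.factorial : ℝ) * ‖c j‖ ^ 2) ∧
    ∀ q, HasSum (fun j => hermiteQ j k q * c j) (f q)}
  zero_mem' := ⟨0, by simp [summable_zero], fun q => by simp⟩
  add_mem' := by
    rintro f g ⟨c, hc, hf⟩ ⟨d, hd, hg⟩
    refine ⟨c + d, ?_, fun q => ?_⟩
    · refine Summable.of_nonneg_of_le (fun j => by positivity) (fun j => ?_)
        ((hc.add hd).mul_left 2)
      have h1 : ‖c j + d j‖ ^ 2 ≤ 2 * (‖c j‖ ^ 2 + ‖d j‖ ^ 2) := by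
        have h := norm_add_le (c j) (d j)
        nlinarith [norm_nonneg (c j + d j), sq_nonneg (‖c j‖ - ‖d j‖)]
      have h2 : (0 : ℝ) ≤ (j.factorial : ℝ) := by positivity
      simp only [Pi.add_apply]
      nlinarith [mul_le_mul_of_nonneg_left h1 h2]
    · simpa [mul_add] using (hf q).add (hg q)
  smul_mem' := by
    rintro a f ⟨c, hc, hf⟩
    refine ⟨fun j => c j * a.unop, ?_, fun q => ?_⟩
    · refine (hc.mul_right (‖a.unop‖ ^ 2)).congr fun j => ?_
      rw [norm_mul]; ring
    · simpa [mul_assoc] using (hf q).mul_right a.unop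

/-- The Bargmann space of level `k` as a subspace of `L²(ℂ_I; e^{-|q|²} dλ_I)`: the classes of
the restrictions to `ℂ_I` of its elements. -/
def bargmannSlice (I : ℍ[ℝ]) (k : ℕ) : Submodule ℍ[ℝ]ᵐᵒᵖ (SliceL2 I) where
  carrier := {F | ∃ f ∈ bargmann k, ∀ᵐ q ∂(sliceGaussian I), F q = f (q : ℍ[ℝ])}
  zero_mem' := ⟨0, zero_mem _, by
    filter_upwards [Lp.coeFn_zero ℍ[ℝ] 2 (sliceGaussian I)] with q hq
    simpa using hq⟩
  add_mem' := by
    rintro F G ⟨f, hf, hF⟩ ⟨g, hg, hG⟩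
    refine ⟨f + g, add_mem hf hg, ?_⟩
    filter_upwards [hF, hG, Lp.coeFn_add F G] with q h1 h2 h3
    rw [h3, Pi.add_apply, Pi.add_apply, h1, h2]
  smul_mem' := by
    rintro a F ⟨f, hf, hF⟩
    refine ⟨a • f, Submodule.smul_mem _ a hf, ?_⟩
    filter_upwards [hF, Lp.coeFn_smul a F] with q h1 h2
    simp [h2, h1]

/-- `L²(ℂ_I; e^{-|q|²} dλ_I)` is the orthogonal Hilbert direct sum of the right quaternionic
subspaces `V k`. -/
structure IsHilbertDirectSum (I : ℍ[ℝ]) (V : ℕ → Submodule ℍ[ℝ]ᵐᵒᵖ (SliceL2 I)) : Prop where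
  isClosed : ∀ k, IsClosed (V k : Set (SliceL2 I))
  orthogonal : ∀ k l, k ≠ l → ∀ F ∈ V k, ∀ G ∈ V l, sliceInner I F G = 0
  existsUnique_hasSum : ∀ F : SliceL2 I,
    ∃! G : ℕ → SliceL2 I, (∀ k, G k ∈ V k) ∧ HasSum G F

end SPolyBargmann

end

/-!
The slice `ℂ_I` is an isometric copy of `ℂ` under the algebra embedding `i ↦ I`, and this embedding
carries Itô's complex Hermite polynomials `H_{m,n}(z, z̄)` to the quaternionic ones. Everything
reduces to three facts on `ℂ` with the Gaussian measure.

* The `H_{m,n}` are orthogonal with `‖H_{m,n}‖² = π m! n!`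
  (`integral_star_hermiteC_mul_hermiteC`). The Gaussian moments are computed from the Gamma integral
  and rotation invariance; the raising relation `H_{m+1,n} = z H_{m,n} - n H_{m,n-1}` then gives the
  pairing of every monomial with every `H_{m,n}`.
* The `H_{m,n}` are complete, also for quaternion valued functions
  (`ae_eq_zero_of_integral_hermiteC_mul`). Their complex span is stable under multiplication by `z`
  and `z̄`, hence contains the powers of all real linear forms; a function orthogonal to these has
  vanishing Fourier transform against the Gaussian measure.
* `|H_{j,k}(q)| ≤ k! (1 + |q|)^{j+k}` on all of `ℍ`, so that `∑_j j! |c_j|² < ∞` implies convergence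
  of `∑_j H_{j,k}(q) c_j` at every point (`summable_hermiteQ_mul`).

Consequently `L²(ℂ_I)`, as a real Hilbert space, is the Hilbert sum of the right quaternionic lines
`H_{m,n} ℍ` (`isHilbertSum_hermiteIsometry`). The level `k` of the Bargmann scale is the image of
`ℓ²(ℕ, ℍ)` under the isometry attached to the lines `H_{j,k} ℍ`, `j ∈ ℕ` (`coe_bargmannSlice`), so
it is closed, and grouping the Hilbert sum by `k` gives the decomposition. Quaternionic
orthogonality follows from real orthogonality because the levels are stable under right
multiplication.
-/

namespace SPolyBargmann

/-! ### Complex Hermite polynomials -/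

section Hermite

/-- The complex Hermite polynomial `H_{m,n}(z, z̄)` (Itô's polynomials), with the factorials
collected into binomial coefficients. -/
noncomputable def hermiteC (m n : ℕ) (z : ℂ) : ℂ :=
  ∑ j ∈ Finset.range (m + 1), ((-1) ^ j * (j.factorial * m.choose j * n.choose j : ℕ) : ℂ) *
    (z ^ (m - j) * star z ^ (n - j))

lemma hermiteC_eq_sum_range {m n N : ℕ} (hN : m < N ∨ n < N) (z : ℂ) :
    hermiteC m n z = ∑ j ∈ Finset.range N,
      ((-1) ^ j * (j.factorial * m.choose j * n.choose j : ℕ) : ℂ) *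
        (z ^ (m - j) * star z ^ (n - j)) := by
  have key : ∀ A B : ℕ, (m < A ∨ n < A) → A ≤ B → ∑ j ∈ Finset.range A,
      ((-1) ^ j * (j.factorial * m.choose j * n.choose j : ℕ) : ℂ) *
        (z ^ (m - j) * star z ^ (n - j)) = ∑ j ∈ Finset.range B,
      ((-1) ^ j * (j.factorial * m.choose j * n.choose j : ℕ) : ℂ) *
        (z ^ (m - j) * star z ^ (n - j)) := by
    intro A B hA hAB
    refine Finset.sum_subset (by simpa using hAB) fun j _ hj => ?_
    have hj : A ≤ j := by simpa using hj
    rcases hA with hA | hA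
    · simp [Nat.choose_eq_zero_of_lt (hA.trans_le hj)]
    · simp [Nat.choose_eq_zero_of_lt (hA.trans_le hj)]
  unfold hermiteC
  rw [key _ (max (m + 1) N) (Or.inl (Nat.lt_succ_self m)) (le_max_left _ _),
    key N _ hN (le_max_right _ _)]

lemma star_hermiteC (m n : ℕ) (z : ℂ) : star (hermiteC m n z) = hermiteC n m z := by
  rw [hermiteC_eq_sum_range (N := m + n + 1) (by omega) z,
    hermiteC_eq_sum_range (N := m + n + 1) (by omega) z, star_sum]
  refine Finset.sum_congr rfl fun j _ => ?_
  simp only [star_mul', star_pow, star_star, star_natCast, star_neg, star_one]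
  push_cast
  ring

lemma hermiteC_zero_left (n : ℕ) (z : ℂ) : hermiteC 0 n z = star z ^ n := by
  simp [hermiteC]

/-- The raising relation `H_{m+1,n} = z H_{m,n} - n H_{m,n-1}`. -/
lemma hermiteC_succ_left (m n : ℕ) (z : ℂ) :
    hermiteC (m + 1) n z = z * hermiteC m n z - n * hermiteC m (n - 1) z := by
  rw [hermiteC_eq_sum_range (N := m + 2) (by omega) z,
    hermiteC_eq_sum_range (m := m) (n := n) (N := m + 2) (by omega) z,
    Finset.sum_range_succ', Finset.sum_range_succ' _ (m + 1), mul_add, Finset.mul_sum]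
  unfold hermiteC
  rw [Finset.mul_sum, add_sub_right_comm, ← Finset.sum_sub_distrib]
  congr 1
  · refine Finset.sum_congr rfl fun j hj => ?_
    have e2 : (n : ℂ) * ((n - 1).choose j : ℂ) = (j + 1) * (n.choose (j + 1) : ℂ) := by
      rcases n with _ | n
      · simp
      · have := Nat.add_one_mul_choose_eq n j
        rw [Nat.add_sub_cancel]
        exact_mod_cast this.trans (mul_comm _ _)
    have e3 : n - 1 - j = n - (j + 1) := by omega
    have e1 : (m.choose (j + 1) : ℂ) * z ^ (m - j) =
        m.choose (j + 1) * (z * z ^ (m - (j + 1))) := by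
      rcases Nat.lt_or_ge m (j + 1) with h | h
      · simp [Nat.choose_eq_zero_of_lt h]
      · rw [← pow_succ', show m - (j + 1) + 1 = m - j by omega]
    rw [e3, Nat.choose_succ_succ m j, Nat.factorial_succ, Nat.add_sub_add_right]
    push_cast
    linear_combination ((-1) ^ (j + 1) * (j + 1) * (j.factorial : ℂ) * n.choose (j + 1) *
      star z ^ (n - (j + 1))) * e1 +
      ((-1) ^ j * (j.factorial : ℂ) * m.choose j * z ^ (m - j) * star z ^ (n - (j + 1))) * e2
  · simp [pow_succ', mul_assoc]

lemma hermiteC_succ_right (m n : ℕ) (z : ℂ) :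
    hermiteC m (n + 1) z = star z * hermiteC m n z - m * hermiteC (m - 1) n z := by
  have h := congrArg star (hermiteC_succ_left n m z)
  simpa [star_hermiteC, -RCLike.star_def] using h

/-- The quaternionic Hermite polynomials with the factorials collected into binomial
coefficients. -/
lemma hermiteQ_eq_sum_choose (m n : ℕ) (q : ℍ[ℝ]) :
    hermiteQ m n q = ∑ j ∈ Finset.range (min m n + 1),
      ((-1) ^ j * (j.factorial * m.choose j * n.choose j : ℕ) : ℝ) •
        (q ^ (m - j) * star q ^ (n - j)) := by
  unfold hermiteQ
  rw [Finset.smul_sum]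
  refine Finset.sum_congr rfl fun j hj => ?_
  have hj : j ≤ min m n := by simpa [Nat.lt_succ_iff] using hj
  rw [smul_smul]
  congr 1
  push_cast
  rw [Nat.cast_choose ℝ (hj.trans (min_le_left _ _)),
    Nat.cast_choose ℝ (hj.trans (min_le_right _ _))]
  have := Nat.factorial_ne_zero j
  field_simp

/-- In each summand `j! C(n,j) ≤ n!` and `|q|^{n-j} ≤ (1 + |q|)^n`; what remains is a part of the
binomial expansion of `(1 + |q|)^m`. -/
lemma norm_hermiteQ_le (m n : ℕ) (q : ℍ[ℝ]) :
    ‖hermiteQ m n q‖ ≤ n.factorial * (1 + ‖q‖) ^ n * (1 + ‖q‖) ^ m := by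
  have hq : 0 ≤ ‖q‖ := norm_nonneg q
  rw [hermiteQ_eq_sum_choose]
  calc _ ≤ ∑ j ∈ Finset.range (min m n + 1), (n.factorial : ℝ) * (1 + ‖q‖) ^ n *
        (m.choose j * ‖q‖ ^ (m - j)) := by
        refine norm_sum_le_of_le _ fun j hj => ?_
        have hj : j ≤ n := by
          have : j < min m n + 1 := by simpa using hj
          omega
        have h1 : ((j.factorial * n.choose j : ℕ) : ℝ) ≤ n.factorial := by
          norm_cast
          calc j.factorial * n.choose j = n.descFactorial j :=
                (Nat.descFactorial_eq_factorial_mul_choose n j).symm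
            _ ≤ n.factorial := by
                rw [← Nat.factorial_mul_descFactorial hj]
                exact Nat.le_mul_of_pos_left _ (Nat.factorial_pos _)
        have h2 : ‖q‖ ^ (n - j) ≤ (1 + ‖q‖) ^ n :=
          (pow_le_pow_left₀ hq (by linarith) _).trans
            (pow_le_pow_right₀ (by linarith) (Nat.sub_le _ _))
        simp only [norm_smul, norm_mul, norm_pow, norm_neg, norm_one, one_pow, one_mul,
          Quaternion.norm_star, Real.norm_natCast]
        have h3 := mul_le_mul h1 h2 (by positivity) (by positivity)
        calc _ = (((j.factorial * n.choose j : ℕ) : ℝ) * ‖q‖ ^ (n - j)) *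
              (m.choose j * ‖q‖ ^ (m - j)) := by push_cast; ring
          _ ≤ _ := mul_le_mul_of_nonneg_right h3 (by positivity)
    _ ≤ ∑ j ∈ Finset.range (m + 1), (n.factorial : ℝ) * (1 + ‖q‖) ^ n *
        (m.choose j * ‖q‖ ^ (m - j)) :=
        Finset.sum_le_sum_of_subset_of_nonneg
          (Finset.range_subset_range.2 (by omega)) fun _ _ _ => by positivity
    _ = _ := by
        rw [← Finset.mul_sum, add_pow 1 ‖q‖ m]
        simp [mul_comm]

/-- The coefficient condition `∑ j! |c_j|² < ∞` forces the defining series of the Bargmann space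
to converge at every point of `ℍ`. -/
lemma summable_hermiteQ_mul {c : ℕ → ℍ[ℝ]} (k : ℕ)
    (hc : Summable fun j => (j.factorial : ℝ) * ‖c j‖ ^ 2) (q : ℍ[ℝ]) :
    Summable fun j => hermiteQ j k q * c j := by
  set r : ℝ := 1 + ‖q‖ with hr
  have hr0 : 0 ≤ r := by positivity
  have h1 : Summable fun j : ℕ => (r ^ 2) ^ j / j.factorial := Real.summable_pow_div_factorial _
  refine Summable.of_norm_bounded ((h1.add hc).mul_left (k.factorial * r ^ k)) fun j => ?_
  rw [norm_mul]
  have hA : 0 ≤ k.factorial * r ^ k := by positivity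
  have hj : (0 : ℝ) < j.factorial := by positivity
  -- the inequality of arithmetic and geometric means, with weight `j!`
  have h2 : r ^ j * ‖c j‖ ≤ (r ^ 2) ^ j / j.factorial + j.factorial * ‖c j‖ ^ 2 := by
    rw [← pow_mul, mul_comm 2 j, pow_mul, div_add' _ _ _ hj.ne', le_div_iff₀ hj]
    nlinarith [sq_nonneg (r ^ j - j.factorial * ‖c j‖), pow_nonneg hr0 j,
      mul_nonneg (pow_nonneg hr0 j) (mul_nonneg hj.le (norm_nonneg (c j)))]
  calc _ ≤ (k.factorial * r ^ k * r ^ j) * ‖c j‖ :=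
        mul_le_mul_of_nonneg_right (norm_hermiteQ_le j k q) (norm_nonneg _)
    _ = k.factorial * r ^ k * (r ^ j * ‖c j‖) := by ring
    _ ≤ _ := mul_le_mul_of_nonneg_left h2 hA

end Hermite

/-! ### The slice `ℂ_I` as a copy of `ℂ` -/

section Slice

variable {I : ℍ[ℝ]}

lemma mul_self_of_mem_imaginaryUnits (hI : I ∈ imaginaryUnits) : I * I = -1 := by
  rw [← sq]; exact hI

lemma norm_of_mem_imaginaryUnits (hI : I ∈ imaginaryUnits) : ‖I‖ = 1 := by
  have h := congrArg norm (mul_self_of_mem_imaginaryUnits hI)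
  rw [norm_mul, norm_neg, norm_one] at h
  nlinarith [norm_nonneg I]

lemma star_of_mem_imaginaryUnits (hI : I ∈ imaginaryUnits) : star I = -I := by
  have h2 : I * star I = 1 := by
    rw [Quaternion.self_mul_star, Quaternion.normSq_eq_norm_mul_self,
      norm_of_mem_imaginaryUnits hI]
    simp
  have hI0 : I ≠ 0 := by
    rintro rfl
    simp at h2
  apply mul_left_cancel₀ hI0
  rw [h2, mul_neg, mul_self_of_mem_imaginaryUnits hI, neg_neg]

/-- The algebra embedding `ℂ → ℍ` sending `i` to the imaginary unit `I`. -/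
noncomputable def embed (hI : I ∈ imaginaryUnits) : ℂ →ₐ[ℝ] ℍ[ℝ] :=
  Complex.liftAux I (mul_self_of_mem_imaginaryUnits hI)

lemma embed_apply (hI : I ∈ imaginaryUnits) (z : ℂ) :
    embed hI z = slicePoint I (z.re, z.im) := by
  rw [embed, Complex.liftAux_apply, slicePoint, Quaternion.mul_coe_eq_smul]
  rfl

lemma star_embed (hI : I ∈ imaginaryUnits) (z : ℂ) : star (embed hI z) = embed hI (star z) := by
  simp [embed_apply, slicePoint, star_of_mem_imaginaryUnits hI, Quaternion.coe_commutes]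

lemma norm_embed (hI : I ∈ imaginaryUnits) (z : ℂ) : ‖embed hI z‖ = ‖z‖ := by
  have h : ((‖embed hI z‖ * ‖embed hI z‖ : ℝ) : ℍ[ℝ]) = ((‖z‖ * ‖z‖ : ℝ) : ℍ[ℝ]) := by
    rw [← Quaternion.normSq_eq_norm_mul_self, ← Quaternion.self_mul_star, star_embed, ← map_mul,
      Complex.star_def, Complex.mul_conj, Complex.normSq_eq_norm_sq, sq]
    exact (embed hI).commutes _
  have h := Quaternion.coe_injective h
  nlinarith [norm_nonneg (embed hI z), norm_nonneg z, abs_nonneg (‖embed hI z‖ - ‖z‖)]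

lemma hermiteQ_embed (hI : I ∈ imaginaryUnits) (m n : ℕ) (z : ℂ) :
    hermiteQ m n (embed hI z) = embed hI (hermiteC m n z) := by
  rw [hermiteQ_eq_sum_choose, hermiteC_eq_sum_range (N := min m n + 1) (by omega), map_sum]
  refine Finset.sum_congr rfl fun j _ => ?_
  rw [star_embed, ← map_pow, ← map_pow, ← map_mul, ← map_smul, Complex.real_smul]
  push_cast
  rfl

lemma norm_hermiteC_le (m n : ℕ) (z : ℂ) :
    ‖hermiteC m n z‖ ≤ n.factorial * (1 + ‖z‖) ^ n * (1 + ‖z‖) ^ m := by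
  obtain ⟨I, hI⟩ : ∃ I : ℍ[ℝ], I ∈ imaginaryUnits :=
    ⟨Quaternion.ofComplex Complex.I, by
      change _ ^ 2 = _
      rw [← map_pow, Complex.I_sq, map_neg, map_one]⟩
  rw [← norm_embed hI, ← hermiteQ_embed, ← norm_embed hI z]
  exact norm_hermiteQ_le _ _ _

end Slice

/-! ### The Gaussian measure on `ℂ` -/

section Gaussian

/-- The (unnormalised) Gaussian measure `e^{-|z|²} dx dy` on `ℂ`; its total mass is `π`. -/
noncomputable def gaussianC : Measure ℂ :=
  volume.withDensity fun z => ENNReal.ofReal (Real.exp (-‖z‖ ^ 2))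

lemma integral_gaussianC {E : Type*} [NormedAddCommGroup E] [NormedSpace ℝ E] (g : ℂ → E) :
    ∫ z, g z ∂gaussianC = ∫ z, Real.exp (-‖z‖ ^ 2) • g z := by
  rw [gaussianC, integral_withDensity_eq_integral_toReal_smul (by fun_prop) (by simp)]
  simp [ENNReal.toReal_ofReal (Real.exp_nonneg _)]

lemma integrable_gaussianC_iff {E : Type*} [NormedAddCommGroup E] [NormedSpace ℝ E] {g : ℂ → E} :
    Integrable g gaussianC ↔ Integrable fun z => Real.exp (-‖z‖ ^ 2) • g z := by
  rw [gaussianC, integrable_withDensity_iff_integrable_smul' (by fun_prop) (by simp)]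
  simp [ENNReal.toReal_ofReal (Real.exp_nonneg _)]

lemma integrable_exp_norm (c : ℝ) : Integrable (fun z : ℂ => Real.exp (c * ‖z‖)) gaussianC := by
  rw [integrable_gaussianC_iff]
  have h := (GaussianFourier.integrable_cexp_neg_mul_sq_norm_add (V := ℂ) (b := (1 / 2 : ℂ))
    (by norm_num) 0 0).norm.const_mul (Real.exp (c ^ 2 / 2))
  refine h.mono' (by fun_prop) (Filter.Eventually.of_forall fun z => ?_)
  rw [Complex.norm_exp, smul_eq_mul, ← Real.exp_add, ← Real.exp_add, Real.norm_eq_abs,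
    Real.abs_exp, Real.exp_le_exp]
  have : (-(1 / 2 : ℂ) * (‖z‖ : ℂ) ^ 2 + 0 * ((inner ℝ (0 : ℂ) z : ℝ) : ℂ)).re
      = -(1 / 2) * ‖z‖ ^ 2 := by
    rw [zero_mul, add_zero]
    rw [show (-(1 / 2 : ℂ) * (‖z‖ : ℂ) ^ 2) = ((-(1 / 2) * ‖z‖ ^ 2 : ℝ) : ℂ) by push_cast; rfl,
      Complex.ofReal_re]
  rw [this]
  nlinarith [sq_nonneg (c - ‖z‖)]

instance : IsFiniteMeasure gaussianC := by
  have h := integrable_exp_norm 0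
  simp only [zero_mul, Real.exp_zero] at h
  exact (integrable_const_iff_isFiniteMeasure one_ne_zero).1 h

/-- Continuous functions on `ℂ` of at most exponential growth; all of them lie in `L^p` of the
Gaussian measure for every finite `p`. -/
structure ExpBounded {E : Type*} [NormedAddCommGroup E] (f : ℂ → E) : Prop where
  continuous : Continuous f
  bound : ∃ C c : ℝ, ∀ z, ‖f z‖ ≤ C * Real.exp (c * ‖z‖)

lemma ExpBounded.integrable {E : Type*} [NormedAddCommGroup E] {f : ℂ → E} (hf : ExpBounded f) :
    Integrable f gaussianC := by
  obtain ⟨C, c, h⟩ := hf.bound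
  exact ((integrable_exp_norm c).const_mul C).mono' hf.continuous.aestronglyMeasurable
    (Filter.Eventually.of_forall h)

lemma ExpBounded.memLp {E : Type*} [NormedAddCommGroup E] {f : ℂ → E}
    (hf : ExpBounded f) : MemLp f 2 gaussianC := by
  rw [memLp_two_iff_integrable_sq_norm hf.continuous.aestronglyMeasurable]
  obtain ⟨C, c, h⟩ := hf.bound
  refine ExpBounded.integrable ⟨by have := hf.continuous; fun_prop, C ^ 2, 2 * c, fun z => ?_⟩
  rw [norm_pow, norm_norm]
  calc _ ≤ (C * Real.exp (c * ‖z‖)) ^ 2 := pow_le_pow_left₀ (norm_nonneg _) (h z) 2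
    _ = _ := by rw [mul_pow, ← Real.exp_nat_mul]; congr 2; push_cast; ring

lemma ExpBounded.mul {f g : ℂ → ℂ} (hf : ExpBounded f) (hg : ExpBounded g) :
    ExpBounded fun z => f z * g z := by
  obtain ⟨C, c, h⟩ := hf.bound
  obtain ⟨D, d, h'⟩ := hg.bound
  refine ⟨hf.continuous.mul hg.continuous, C * D, c + d, fun z => ?_⟩
  rw [norm_mul, add_mul, Real.exp_add]
  calc _ ≤ (C * Real.exp (c * ‖z‖)) * (D * Real.exp (d * ‖z‖)) :=
        mul_le_mul (h z) (h' z) (norm_nonneg _) ((norm_nonneg _).trans (h z))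
    _ = _ := by ring

lemma expBounded_monomial (a b : ℕ) : ExpBounded fun z : ℂ => z ^ a * star z ^ b := by
  refine ⟨by fun_prop, 1, a + b, fun z => ?_⟩
  have h : ‖z‖ ≤ Real.exp ‖z‖ := by linarith [Real.add_one_le_exp ‖z‖]
  rw [norm_mul, norm_pow, norm_pow, Complex.star_def, Complex.norm_conj, ← pow_add, one_mul,
    ← Nat.cast_add, Real.exp_nat_mul]
  exact pow_le_pow_left₀ (norm_nonneg _) h _

lemma continuous_hermiteC (m n : ℕ) : Continuous (hermiteC m n) := by
  unfold hermiteC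
  fun_prop

lemma expBounded_hermiteC (m n : ℕ) : ExpBounded (hermiteC m n) := by
  refine ⟨continuous_hermiteC m n, n.factorial, (n + m : ℕ), fun z => ?_⟩
  have h : 1 + ‖z‖ ≤ Real.exp ‖z‖ := by linarith [Real.add_one_le_exp ‖z‖]
  refine (norm_hermiteC_le m n z).trans ?_
  rw [mul_assoc, ← pow_add, Real.exp_nat_mul]
  gcongr

/-- The Gaussian moments; the off-diagonal ones vanish by rotation invariance. -/
lemma integral_monomial (a b : ℕ) :
    ∫ z, z ^ a * star z ^ b ∂gaussianC = if a = b then (Real.pi * a.factorial : ℂ) else 0 := by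
  rw [integral_gaussianC]
  split_ifs with h
  · subst h
    have h1 := Complex.integral_rpow_mul_exp_neg_rpow (p := 2) (q := (2 * a : ℕ)) (by norm_num)
      (by have : (0 : ℝ) ≤ ((2 * a : ℕ) : ℝ) := by positivity
          linarith)
    have h2 : (((2 * a : ℕ) : ℝ) + 2) / 2 = a + 1 := by push_cast; ring
    rw [h2, Real.Gamma_nat_eq_factorial] at h1
    have h3 : ∀ z : ℂ, Real.exp (-‖z‖ ^ 2) • (z ^ a * star z ^ a)
        = ((‖z‖ ^ ((2 * a : ℕ) : ℝ) * Real.exp (-‖z‖ ^ (2 : ℝ)) : ℝ) : ℂ) := by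
      intro z
      rw [← mul_pow, Complex.star_def, Complex.mul_conj, Complex.normSq_eq_norm_sq,
        Real.rpow_natCast, Real.rpow_two, Complex.real_smul, pow_mul]
      push_cast
      ring
    simp_rw [h3]
    rw [integral_complex_ofReal, h1]
    push_cast
    ring
  · -- rotating by the angle `π / (a - b)` changes the sign of the integral
    set t : ℝ := Real.pi / ((a : ℝ) - b) with ht
    have hab : (a : ℝ) - b ≠ 0 := sub_ne_zero.2 (by exact_mod_cast h)
    have hω : ((Circle.exp t : Circle) : ℂ) ^ a * star ((Circle.exp t : Circle) : ℂ) ^ b = -1 := by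
      rw [Complex.star_def, Circle.coe_exp, ← Complex.exp_conj, ← Complex.exp_nat_mul,
        ← Complex.exp_nat_mul, ← Complex.exp_add, ← Complex.exp_pi_mul_I]
      congr 1
      have : (t : ℂ) * ((a : ℂ) - b) = Real.pi := by
        rw [← Complex.ofReal_natCast, ← Complex.ofReal_natCast, ← Complex.ofReal_sub,
          ← Complex.ofReal_mul, ht, div_mul_cancel₀ _ hab]
      simp only [map_mul, Complex.conj_ofReal, Complex.conj_I]
      linear_combination Complex.I * this
    have h1 := (rotation (Circle.exp t)).measurePreserving.integral_comp
      (rotation (Circle.exp t)).toHomeomorph.measurableEmbedding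
      (fun z : ℂ => Real.exp (-‖z‖ ^ 2) • (z ^ a * star z ^ b))
    have h2 : ∀ z : ℂ, Real.exp (-‖rotation (Circle.exp t) z‖ ^ 2) •
        ((rotation (Circle.exp t) z) ^ a * star (rotation (Circle.exp t) z) ^ b)
        = -(Real.exp (-‖z‖ ^ 2) • (z ^ a * star z ^ b)) := by
      intro z
      rw [LinearIsometryEquiv.norm_map, rotation_apply, star_mul', mul_pow, mul_pow, ← smul_neg]
      congr 1
      linear_combination (z ^ a * star z ^ b) * hω
    simp_rw [h2] at h1
    rw [integral_neg] at h1
    exact self_eq_neg.1 h1.symm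

/-- The pairing of a monomial with a Hermite polynomial, obtained from the moments by induction
along the raising relation. -/
lemma integral_monomial_mul_hermiteC (a b m n : ℕ) :
    ∫ z, z ^ a * star z ^ b * hermiteC m n z ∂gaussianC =
      if a + m = b + n then (Real.pi * (a.descFactorial n * b.factorial : ℕ) : ℂ) else 0 := by
  induction m generalizing a n with
  | zero =>
    simp_rw [hermiteC_zero_left, mul_assoc, ← pow_add]
    rw [integral_monomial]
    simp only [add_zero]
    split_ifs with h
    · rw [h, ← Nat.factorial_mul_descFactorial (Nat.le_add_left n b), Nat.add_sub_cancel]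
      push_cast
      ring
    · rfl
  | succ m ih =>
    have e : ∀ z : ℂ, z ^ a * star z ^ b * hermiteC (m + 1) n z =
        z ^ (a + 1) * star z ^ b * hermiteC m n z
          - n * (z ^ a * star z ^ b * hermiteC m (n - 1) z) := by
      intro z
      rw [hermiteC_succ_left]
      ring
    simp_rw [e]
    rw [integral_sub ((expBounded_monomial _ _).mul (expBounded_hermiteC _ _)).integrable
      (((expBounded_monomial _ _).mul (expBounded_hermiteC _ _)).integrable.const_mul _),
      integral_const_mul, ih, ih]
    rcases n with _ | n
    · simp [add_right_comm a 1 m, add_assoc]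
    · have e1 : (a + 1 + m = b + (n + 1)) ↔ (a + (m + 1) = b + (n + 1)) := by omega
      have e2 : (a + m = b + (n + 1 - 1)) ↔ (a + (m + 1) = b + (n + 1)) := by omega
      simp only [e1, e2]
      split_ifs with h
      · have : (a + 1).descFactorial (n + 1) =
            a.descFactorial (n + 1) + (n + 1) * a.descFactorial n := by
          rw [Nat.succ_descFactorial_succ, Nat.descFactorial_succ]
          rcases Nat.lt_or_ge a n with h | h
          · simp [Nat.descFactorial_eq_zero_iff_lt.2 h]
          · rw [← add_mul]
            congr 1
            omega
        rw [this]
        push_cast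
        ring
      · simp

/-- In the expansion of `star H_{k,l}` the power of `z` is at most `l < n`, and such monomials are
orthogonal to `H_{m,n}`. -/
lemma integral_star_hermiteC_mul_hermiteC_of_lt {k l m n : ℕ} (h : l < n) :
    ∫ z, star (hermiteC k l z) * hermiteC m n z ∂gaussianC = 0 := by
  have e : ∀ z : ℂ, star (hermiteC k l z) * hermiteC m n z = ∑ j ∈ Finset.range (l + 1),
      ((-1) ^ j * (j.factorial * l.choose j * k.choose j : ℕ) : ℂ) *
        (z ^ (l - j) * star z ^ (k - j) * hermiteC m n z) := by
    intro z
    rw [star_hermiteC, hermiteC, Finset.sum_mul]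
    simp_rw [mul_assoc]
  simp_rw [e]
  rw [integral_finsetSum _ fun j _ =>
    ((expBounded_monomial _ _).mul (expBounded_hermiteC _ _)).integrable.const_mul _]
  refine Finset.sum_eq_zero fun j _ => ?_
  rw [integral_const_mul, integral_monomial_mul_hermiteC,
    Nat.descFactorial_eq_zero_iff_lt.2 (by omega : l - j < n)]
  simp

/-- Orthogonality of the complex Hermite polynomials, with their squared norms. -/
lemma integral_star_hermiteC_mul_hermiteC (k l m n : ℕ) :
    ∫ z, star (hermiteC k l z) * hermiteC m n z ∂gaussianC =
      if k = m ∧ l = n then (Real.pi * (m.factorial * n.factorial : ℕ) : ℂ) else 0 := by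
  rcases lt_trichotomy l n with h | rfl | h
  · rw [integral_star_hermiteC_mul_hermiteC_of_lt h, if_neg (by omega)]
  · have e : ∀ z : ℂ, star (hermiteC k l z) * hermiteC m l z = ∑ j ∈ Finset.range (l + 1),
        ((-1) ^ j * (j.factorial * l.choose j * k.choose j : ℕ) : ℂ) *
          (z ^ (l - j) * star z ^ (k - j) * hermiteC m l z) := by
      intro z
      rw [star_hermiteC, hermiteC, Finset.sum_mul]
      simp_rw [mul_assoc]
    -- only the leading monomial of `star H_{k,l}` contributes
    simp_rw [e]
    rw [integral_finsetSum _ fun j _ =>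
      ((expBounded_monomial _ _).mul (expBounded_hermiteC _ _)).integrable.const_mul _,
      Finset.sum_range_succ', Finset.sum_eq_zero, zero_add]
    · rw [integral_const_mul, integral_monomial_mul_hermiteC]
      rcases eq_or_ne k m with rfl | hkm
      · simp [add_comm, Nat.descFactorial_self]
        ring
      · rw [if_neg (by omega), if_neg (by simp [hkm]), mul_zero]
    · intro j hj
      rw [integral_const_mul, integral_monomial_mul_hermiteC]
      rcases Nat.eq_zero_or_pos l with rfl | hl
      · simp
      · rw [Nat.descFactorial_eq_zero_iff_lt.2 (by omega : l - (j + 1) < l)]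
        simp
  · rw [if_neg (by omega)]
    have h1 := congrArg (starRingEnd ℂ)
      (integral_star_hermiteC_mul_hermiteC_of_lt (k := m) (m := k) h)
    rw [← integral_conj, map_zero] at h1
    rw [← h1]
    congr 1
    ext z
    simp [mul_comm]

end Gaussian

/-! ### Completeness of the Hermite polynomials -/

section Completeness

/-- Orthogonality to all powers of real linear forms makes the Fourier transform vanish: expand
the exponential. -/
lemma integral_exp_inner_mul_eq_zero {f : ℂ → ℝ} (hf : MemLp f 2 gaussianC) (w : ℂ)
    (h : ∀ n : ℕ, ∫ z, inner ℝ z w ^ n * f z ∂gaussianC = 0) :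
    ∫ z, Complex.exp ((inner ℝ z w : ℝ) * Complex.I) * f z ∂gaussianC = 0 := by
  have hint : Integrable f gaussianC := hf.integrable (by norm_num)
  have hR : ∀ x : ℝ, HasSum (fun n : ℕ => x ^ n / n.factorial) (Real.exp x) := fun x => by
    rw [Real.exp_eq_exp_ℝ]
    exact NormedSpace.expSeries_div_hasSum_exp x
  have hC : ∀ x : ℂ, HasSum (fun n : ℕ => x ^ n / n.factorial) (Complex.exp x) := fun x => by
    rw [Complex.exp_eq_exp_ℂ]
    exact NormedSpace.expSeries_div_hasSum_exp x
  have hE : ExpBounded fun z : ℂ => Real.exp (‖w‖ * ‖z‖) :=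
    ⟨by fun_prop, 1, ‖w‖, fun z => by simp⟩
  have hdom : Integrable (fun z : ℂ => Real.exp (‖w‖ * ‖z‖) * ‖f z‖) gaussianC :=
    hE.memLp.integrable_mul hf.norm
  have hbound : ∀ z : ℂ, HasSum (fun n : ℕ => (‖w‖ * ‖z‖) ^ n / n.factorial * ‖f z‖)
      (Real.exp (‖w‖ * ‖z‖) * ‖f z‖) := fun z => (hR _).mul_right _
  have hs := hasSum_integral_of_dominated_convergence (μ := gaussianC)
    (F := fun (n : ℕ) z => (((inner ℝ z w : ℝ) * Complex.I) ^ n / n.factorial : ℂ) * f z)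
    (f := fun z => Complex.exp ((inner ℝ z w : ℝ) * Complex.I) * f z)
    (fun n z => (‖w‖ * ‖z‖) ^ n / n.factorial * ‖f z‖)
    (fun n => by
      refine AEStronglyMeasurable.mul ?_
        (Complex.continuous_ofReal.comp_aestronglyMeasurable hint.1)
      exact Continuous.aestronglyMeasurable (by fun_prop))
    (fun n => Filter.Eventually.of_forall fun z => by
      simp only [norm_mul, norm_div, norm_pow, Complex.norm_I, mul_one, Complex.norm_real,
        Complex.norm_natCast]
      gcongr
      rw [mul_comm]
      exact norm_inner_le_norm z w)
    (Filter.Eventually.of_forall fun z => (hbound z).summable)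
    (hdom.congr (Filter.Eventually.of_forall fun z => (hbound z).tsum_eq.symm))
    (Filter.Eventually.of_forall fun z => (hC _).mul_right _)
  have hz : ∀ n : ℕ, ∫ z, (((inner ℝ z w : ℝ) * Complex.I) ^ n / n.factorial : ℂ) * f z
      ∂gaussianC = 0 := by
    intro n
    have e : ∀ z : ℂ, (((inner ℝ z w : ℝ) * Complex.I) ^ n / n.factorial : ℂ) * f z =
        (Complex.I ^ n / n.factorial) * ((inner ℝ z w ^ n * f z : ℝ) : ℂ) := by
      intro z
      push_cast
      ring
    simp_rw [e]
    rw [integral_const_mul, integral_complex_ofReal, h n]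
    simp
  simp_rw [hz] at hs
  exact hs.unique hasSum_zero

/-- A function that is square integrable for the Gaussian measure vanishes if it is orthogonal to
all powers of real linear forms: its positive and its negative part are densities of two finite
measures with the same characteristic function. -/
lemma ae_eq_zero_of_integral_inner_pow {f : ℂ → ℝ} (hf : MemLp f 2 gaussianC)
    (h : ∀ (w : ℂ) (n : ℕ), ∫ z, inner ℝ z w ^ n * f z ∂gaussianC = 0) :
    f =ᵐ[gaussianC] 0 := by
  have hint : Integrable f gaussianC := hf.integrable (by norm_num)
  have hF := fun w : ℂ => integral_exp_inner_mul_eq_zero hf w (h w)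
  set g : ℂ → ℝ := hint.1.mk f with hg
  have hfg : f =ᵐ[gaussianC] g := hint.1.ae_eq_mk
  have hgm : Measurable g := hint.1.stronglyMeasurable_mk.measurable
  have hgi : Integrable g gaussianC := hint.congr hfg
  have hfin : ∀ u : ℂ → ℝ, Integrable u gaussianC →
      ∫⁻ z, ENNReal.ofReal (u z) ∂gaussianC ≠ ⊤ := fun u hu =>
    ((lintegral_mono fun z => Real.ofReal_le_enorm _).trans_lt hu.2).ne
  have hpos := hfin g hgi
  have hneg := hfin _ hgi.neg
  have : IsFiniteMeasure (gaussianC.withDensity fun z => ENNReal.ofReal (g z)) :=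
    isFiniteMeasure_withDensity hpos
  have : IsFiniteMeasure (gaussianC.withDensity fun z => ENNReal.ofReal ((-g) z)) :=
    isFiniteMeasure_withDensity hneg
  have key : (gaussianC.withDensity fun z => ENNReal.ofReal (g z)) =
      gaussianC.withDensity fun z => ENNReal.ofReal ((-g) z) := by
    refine Measure.ext_of_charFun (funext fun w => ?_)
    rw [charFun_apply, charFun_apply,
      integral_withDensity_eq_integral_toReal_smul (by fun_prop) (by simp),
      integral_withDensity_eq_integral_toReal_smul (by fun_prop) (by simp), ← sub_eq_zero,
      ← integral_sub]
    · rw [← hF w]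
      refine integral_congr_ae ?_
      filter_upwards [hfg] with z hz
      rw [hz, ← sub_smul, ENNReal.toReal_ofReal', ENNReal.toReal_ofReal',
        Complex.real_smul, mul_comm, Pi.neg_apply, max_zero_sub_max_neg_zero_eq_self]
    · refine (hgi.norm).mono' ?_ (Filter.Eventually.of_forall fun z => ?_)
      · exact (by fun_prop : Measurable _).aestronglyMeasurable
      · rw [norm_smul, Complex.norm_exp_ofReal_mul_I, mul_one, ENNReal.toReal_ofReal',
          Real.norm_eq_abs, Real.norm_eq_abs, abs_of_nonneg (le_max_right _ _)]
        exact max_le (le_abs_self _) (abs_nonneg _)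
    · refine (hgi.norm).mono' ?_ (Filter.Eventually.of_forall fun z => ?_)
      · exact (by fun_prop : Measurable _).aestronglyMeasurable
      · rw [norm_smul, Complex.norm_exp_ofReal_mul_I, mul_one, ENNReal.toReal_ofReal',
          Real.norm_eq_abs, Real.norm_eq_abs, abs_of_nonneg (le_max_right _ _)]
        exact max_le (neg_le_abs _) (abs_nonneg _)
  have key := (withDensity_eq_iff (by fun_prop) (by fun_prop) hpos).1 key
  filter_upwards [hfg, key] with z hz hz'
  rw [hz, Pi.zero_apply]
  have h1 := congrArg ENNReal.toReal hz'
  rw [ENNReal.toReal_ofReal', ENNReal.toReal_ofReal'] at h1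
  have h2 := max_zero_sub_max_neg_zero_eq_self (g z)
  simp only [Pi.neg_apply] at h1
  rw [← h2, h1, sub_self]

/-- The complex span of the Hermite polynomials; it is the space of all polynomials in
`z` and `z̄`. -/
noncomputable def hermiteSpan : Submodule ℂ (ℂ → ℂ) :=
  Submodule.span ℂ (Set.range fun p : ℕ × ℕ => hermiteC p.1 p.2)

lemma hermiteC_mem_hermiteSpan (m n : ℕ) : hermiteC m n ∈ hermiteSpan :=
  Submodule.subset_span ⟨(m, n), rfl⟩

lemma id_mul_mem_hermiteSpan {φ : ℂ → ℂ} (hφ : φ ∈ hermiteSpan) :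
    (fun z => z * φ z) ∈ hermiteSpan := by
  induction hφ using Submodule.span_induction with
  | mem x hx =>
    obtain ⟨⟨m, n⟩, rfl⟩ := hx
    have : (fun z => z * hermiteC m n z) = hermiteC (m + 1) n + (n : ℂ) • hermiteC m (n - 1) := by
      ext z
      simp [hermiteC_succ_left]
    simp only [this]
    exact add_mem (hermiteC_mem_hermiteSpan _ _)
      (Submodule.smul_mem _ _ (hermiteC_mem_hermiteSpan _ _))
  | zero =>
    simp only [Pi.zero_apply, mul_zero]
    exact hermiteSpan.zero_mem
  | add x y _ _ hx hy => simpa [mul_add, Pi.add_def] using add_mem hx hy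
  | smul c x _ hx => simpa [mul_left_comm, Pi.smul_def] using Submodule.smul_mem _ c hx

lemma star_mul_mem_hermiteSpan {φ : ℂ → ℂ} (hφ : φ ∈ hermiteSpan) :
    (fun z => star z * φ z) ∈ hermiteSpan := by
  induction hφ using Submodule.span_induction with
  | mem x hx =>
    obtain ⟨⟨m, n⟩, rfl⟩ := hx
    have : (fun z => star z * hermiteC m n z) =
        hermiteC m (n + 1) + (m : ℂ) • hermiteC (m - 1) n := by
      ext z
      simp [hermiteC_succ_right]
    simp only [this]
    exact add_mem (hermiteC_mem_hermiteSpan _ _)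
      (Submodule.smul_mem _ _ (hermiteC_mem_hermiteSpan _ _))
  | zero =>
    simp only [Pi.zero_apply, mul_zero]
    exact hermiteSpan.zero_mem
  | add x y _ _ hx hy => simpa [mul_add, Pi.add_def] using add_mem hx hy
  | smul c x _ hx => simpa [mul_left_comm, Pi.smul_def] using Submodule.smul_mem _ c hx

lemma inner_pow_mem_hermiteSpan (w : ℂ) (n : ℕ) :
    (fun z : ℂ => ((inner ℝ z w ^ n : ℝ) : ℂ)) ∈ hermiteSpan := by
  induction n with
  | zero =>
    convert hermiteC_mem_hermiteSpan 0 0 using 1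
    ext z
    simp [hermiteC]
  | succ n ih =>
    have e : (fun z : ℂ => ((inner ℝ z w ^ (n + 1) : ℝ) : ℂ)) =
        (star w / 2) • (fun z : ℂ => z * ((inner ℝ z w ^ n : ℝ) : ℂ)) +
        (w / 2) • (fun z : ℂ => star z * ((inner ℝ z w ^ n : ℝ) : ℂ)) := by
      ext z
      have h : ((inner ℝ z w : ℝ) : ℂ) = (star w / 2) * z + (w / 2) * star z := by
        apply Complex.ext <;> simp [Complex.inner] <;> ring
      simp only [Pi.add_apply, Pi.smul_apply, smul_eq_mul, pow_succ, Complex.ofReal_mul, h]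
      ring
    rw [e]
    exact add_mem (Submodule.smul_mem _ _ (id_mul_mem_hermiteSpan ih))
      (Submodule.smul_mem _ _ (star_mul_mem_hermiteSpan ih))

variable {I : ℍ[ℝ]}

lemma continuous_embed (hI : I ∈ imaginaryUnits) : Continuous (embed hI) :=
  (AddMonoidHomClass.isometry_of_norm (embed hI) (norm_embed hI)).continuous

lemma ExpBounded.embed {φ : ℂ → ℂ} (hI : I ∈ imaginaryUnits) (hφ : ExpBounded φ) :
    ExpBounded fun z => embed hI (φ z) :=
  ⟨(continuous_embed hI).comp hφ.continuous, by simpa only [norm_embed] using hφ.bound⟩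

/-- Completeness of the Hermite polynomials in the space of quaternion valued functions. -/
lemma ae_eq_zero_of_integral_hermiteC_mul (hI : I ∈ imaginaryUnits) {F : ℂ → ℍ[ℝ]}
    (hF : MemLp F 2 gaussianC)
    (h : ∀ m n, ∫ z, embed hI (hermiteC m n z) * F z ∂gaussianC = 0) : F =ᵐ[gaussianC] 0 := by
  have hspan : ∀ φ ∈ hermiteSpan, Integrable (fun z => embed hI (φ z) * F z) gaussianC ∧
      ∫ z, embed hI (φ z) * F z ∂gaussianC = 0 := by
    intro φ hφ
    induction hφ using Submodule.span_induction with
    | mem x hx =>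
      obtain ⟨⟨m, n⟩, rfl⟩ := hx
      exact ⟨((expBounded_hermiteC m n).embed hI).memLp.integrable_mul hF, h m n⟩
    | zero => simp
    | add x y _ _ hx hy =>
      simp only [Pi.add_apply, map_add, add_mul]
      exact ⟨hx.1.add hy.1, by rw [integral_add hx.1 hy.1, hx.2, hy.2, add_zero]⟩
    | smul c x _ hx =>
      simp only [Pi.smul_apply, smul_eq_mul, map_mul, mul_assoc]
      exact ⟨hx.1.const_mul _, by rw [integral_const_mul_of_integrable hx.1, hx.2, mul_zero]⟩
  refine ae_eq_zero_of_forall_inner (𝕜 := ℝ) fun a => ?_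
  refine ae_eq_zero_of_integral_inner_pow (hF.const_inner (𝕜 := ℝ) a) fun w n => ?_
  obtain ⟨h1, h2⟩ := hspan _ (inner_pow_mem_hermiteSpan w n)
  have e : ∀ z : ℂ, embed hI ((inner ℝ z w ^ n : ℝ) : ℂ) * F z = (inner ℝ z w ^ n : ℝ) • F z := by
    intro z
    have : embed hI ((inner ℝ z w ^ n : ℝ) : ℂ) = ((inner ℝ z w ^ n : ℝ) : ℍ[ℝ]) :=
      (embed hI).commutes _
    rw [this, Quaternion.coe_mul_eq_smul]
  simp only [e] at h1 h2
  have h3 := integral_inner (𝕜 := ℝ) h1 a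
  rw [h2, inner_zero_right] at h3
  simpa only [real_inner_smul_right] using h3

end Completeness

/-! ### Transfer to the slice -/

section Transfer

variable {I : ℍ[ℝ]}

/-- The parametrisation `x + i y ↦ x + I y` of the slice `ℂ_I` by `ℂ`. -/
noncomputable def sliceMap (hI : I ∈ imaginaryUnits) (z : ℂ) : slice I :=
  ⟨embed hI z, (z.re, z.im), (embed_apply hI z).symm⟩

lemma coe_sliceMap (hI : I ∈ imaginaryUnits) (z : ℂ) :
    (sliceMap hI z : ℍ[ℝ]) = embed hI z := rfl

lemma isometry_sliceMap (hI : I ∈ imaginaryUnits) : Isometry (sliceMap hI) :=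
  (AddMonoidHomClass.isometry_of_norm (embed hI) (norm_embed hI))

lemma measurableEmbedding_sliceMap (hI : I ∈ imaginaryUnits) :
    MeasurableEmbedding (sliceMap hI) :=
  (isometry_sliceMap hI).isClosedEmbedding.measurableEmbedding

lemma measurePreserving_sliceMap (hI : I ∈ imaginaryUnits) :
    MeasurePreserving (sliceMap hI) gaussianC (sliceGaussian I) := by
  have hm := (measurableEmbedding_sliceMap hI).measurable
  refine ⟨hm, ?_⟩
  have hpt : Measurable (Set.rangeFactorization (slicePoint I)) := by
    have h : Continuous (slicePoint I) := by
      unfold slicePoint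
      have := Quaternion.continuous_coe
      fun_prop
    exact h.measurable.subtype_mk
  have hL : sliceLebesgue I = volume.map (sliceMap hI) := by
    have h := Measure.map_map (μ := volume) hpt Complex.measurableEquivRealProd.measurable
    rw [Complex.volume_preserving_equiv_real_prod.map_eq] at h
    refine h.trans (congrArg (fun φ => Measure.map φ volume) ?_)
    ext z : 1
    exact Subtype.ext (embed_apply hI z).symm
  ext s hs
  rw [Measure.map_apply hm hs, gaussianC, withDensity_apply _ (hm hs), sliceGaussian,
    withDensity_apply _ hs, hL, setLIntegral_map hs (by fun_prop) hm]
  simp_rw [coe_sliceMap, norm_embed]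

lemma integral_sliceGaussian (hI : I ∈ imaginaryUnits) {E : Type*} [NormedAddCommGroup E]
    [NormedSpace ℝ E] (g : slice I → E) :
    ∫ q, g q ∂sliceGaussian I = ∫ z, g (sliceMap hI z) ∂gaussianC :=
  ((measurePreserving_sliceMap hI).integral_comp (measurableEmbedding_sliceMap hI) g).symm

lemma memLp_hermiteQ (hI : I ∈ imaginaryUnits) (m n : ℕ) :
    MemLp (fun q : slice I => hermiteQ m n q) 2 (sliceGaussian I) := by
  rw [← (measurePreserving_sliceMap hI).map_eq,
    (measurableEmbedding_sliceMap hI).memLp_map_measure_iff]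
  have := ((expBounded_hermiteC m n).embed hI).memLp
  simpa only [Function.comp_def, coe_sliceMap, hermiteQ_embed] using this

/-- The class in `L²` of the Hermite polynomial `H_{m,n}` restricted to the slice. -/
noncomputable def hermiteLp (hI : I ∈ imaginaryUnits) (m n : ℕ) : SliceL2 I :=
  (memLp_hermiteQ hI m n).toLp

lemma coeFn_hermiteLp (hI : I ∈ imaginaryUnits) (m n : ℕ) :
    ∀ᵐ q ∂sliceGaussian I, hermiteLp hI m n q = hermiteQ m n (q : ℍ[ℝ]) :=
  (memLp_hermiteQ hI m n).coeFn_toLp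

lemma inner_mul_mul (x y c d : ℍ[ℝ]) :
    inner ℝ (x * c) (y * d) = inner ℝ (c * star d) (star x * y) := by
  simp only [Quaternion.inner_def, Quaternion.re_mul, Quaternion.imI_mul, Quaternion.imJ_mul,
    Quaternion.imK_mul, Quaternion.re_star, Quaternion.imI_star, Quaternion.imJ_star,
    Quaternion.imK_star]
  ring

lemma integrable_star_mul (F G : SliceL2 I) :
    Integrable (fun q => star (F q) * G q) (sliceGaussian I) := by
  have hF : MemLp (fun q => star (F q)) 2 (sliceGaussian I) :=
    (Lp.memLp F).of_le (continuous_star.comp_aestronglyMeasurable (Lp.memLp F).1)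
      (Filter.Eventually.of_forall fun q => by rw [Quaternion.norm_star])
  exact hF.integrable_mul (Lp.memLp G)

/-- The real inner product of `L²` is the real part of the quaternionic one; together with right
multiplications it determines the latter. -/
lemma inner_op_smul_op_smul (F G : SliceL2 I) (c d : ℍ[ℝ]) :
    inner ℝ (MulOpposite.op c • F) (MulOpposite.op d • G) =
      inner ℝ (c * star d) (sliceInner I F G) := by
  rw [sliceInner, ← integral_inner (integrable_star_mul F G), L2.inner_def]
  refine integral_congr_ae ?_
  filter_upwards [Lp.coeFn_smul (MulOpposite.op c) F, Lp.coeFn_smul (MulOpposite.op d) G]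
    with q h1 h2
  rw [h1, h2]
  exact inner_mul_mul _ _ _ _

lemma sliceInner_hermiteLp (hI : I ∈ imaginaryUnits) (k l m n : ℕ) :
    sliceInner I (hermiteLp hI k l) (hermiteLp hI m n) =
      ((if k = m ∧ l = n then Real.pi * (m.factorial * n.factorial : ℕ) else 0 : ℝ) : ℍ[ℝ]) := by
  have h1 : sliceInner I (hermiteLp hI k l) (hermiteLp hI m n) =
      ∫ q : slice I, star (hermiteQ k l (q : ℍ[ℝ])) * hermiteQ m n (q : ℍ[ℝ])
        ∂sliceGaussian I := by
    refine integral_congr_ae ?_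
    filter_upwards [coeFn_hermiteLp hI k l, coeFn_hermiteLp hI m n] with q h1 h2
    rw [h1, h2]
  rw [h1, integral_sliceGaussian hI]
  simp_rw [coe_sliceMap, hermiteQ_embed, star_embed, ← map_mul]
  let L : ℂ →L[ℝ] ℍ[ℝ] := ⟨(embed hI).toLinearMap, continuous_embed hI⟩
  have hint : Integrable (fun z => star (hermiteC k l z) * hermiteC m n z) gaussianC := by
    simp_rw [star_hermiteC]
    exact ((expBounded_hermiteC l k).mul (expBounded_hermiteC m n)).integrable
  have h2 : ∫ z, embed hI (star (hermiteC k l z) * hermiteC m n z) ∂gaussianC =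
      embed hI (∫ z, star (hermiteC k l z) * hermiteC m n z ∂gaussianC) :=
    L.integral_comp_comm hint
  rw [h2, integral_star_hermiteC_mul_hermiteC]
  have h3 : (if k = m ∧ l = n then (Real.pi * (m.factorial * n.factorial : ℕ) : ℂ) else 0) =
      ((if k = m ∧ l = n then Real.pi * (m.factorial * n.factorial : ℕ) else 0 : ℝ) : ℂ) := by
    split_ifs <;> simp
  rw [h3]
  exact (embed hI).commutes _

lemma inner_hermiteLp (hI : I ∈ imaginaryUnits) (k l m n : ℕ) (c d : ℍ[ℝ]) :
    inner ℝ (MulOpposite.op c • hermiteLp hI k l) (MulOpposite.op d • hermiteLp hI m n) =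
      (if k = m ∧ l = n then Real.pi * (m.factorial * n.factorial : ℕ) else 0) * inner ℝ c d := by
  rw [inner_op_smul_op_smul, sliceInner_hermiteLp, Quaternion.inner_def, Quaternion.star_coe,
    Quaternion.mul_coe_eq_smul, Quaternion.re_smul, Quaternion.inner_def, smul_eq_mul]

/-- The `L²` norm of `H_{m,n}`. -/
noncomputable def hermiteNorm (m n : ℕ) : ℝ := √(Real.pi * (m.factorial * n.factorial : ℕ))

lemma hermiteNorm_pos (m n : ℕ) : 0 < hermiteNorm m n :=
  Real.sqrt_pos.2 (mul_pos Real.pi_pos (by positivity))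

lemma sq_hermiteNorm (m n : ℕ) :
    hermiteNorm m n ^ 2 = Real.pi * (m.factorial * n.factorial : ℕ) :=
  Real.sq_sqrt (mul_nonneg Real.pi_pos.le (by positivity))

/-- The isometry `c ↦ H_{m,n} c / ‖H_{m,n}‖` of `ℍ` onto the right quaternionic line spanned by
`H_{m,n}`. -/
noncomputable def hermiteIsometry (hI : I ∈ imaginaryUnits) (p : ℕ × ℕ) :
    ℍ[ℝ] →ₗᵢ[ℝ] SliceL2 I :=
  LinearMap.isometryOfInner
    { toFun := fun c => MulOpposite.op ((hermiteNorm p.1 p.2)⁻¹ • c) • hermiteLp hI p.1 p.2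
      map_add' := fun c d => by rw [smul_add, MulOpposite.op_add, add_smul]
      map_smul' := fun r c => by
        rw [smul_comm, MulOpposite.op_smul, smul_assoc, RingHom.id_apply] }
    fun c d => by
      simp only [LinearMap.coe_mk, AddHom.coe_mk]
      rw [inner_hermiteLp, real_inner_smul_left, real_inner_smul_right, if_pos ⟨rfl, rfl⟩,
        ← sq_hermiteNorm]
      have := (hermiteNorm_pos p.1 p.2).ne'
      field_simp

lemma hermiteIsometry_apply (hI : I ∈ imaginaryUnits) (p : ℕ × ℕ) (c : ℍ[ℝ]) :
    hermiteIsometry hI p c =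
      MulOpposite.op ((hermiteNorm p.1 p.2)⁻¹ • c) • hermiteLp hI p.1 p.2 := rfl

lemma orthogonalFamily_hermiteIsometry (hI : I ∈ imaginaryUnits) :
    OrthogonalFamily ℝ (fun _ : ℕ × ℕ => ℍ[ℝ]) (hermiteIsometry hI) := by
  intro p p' hp c d
  rw [hermiteIsometry_apply, hermiteIsometry_apply, inner_hermiteLp,
    if_neg (fun h => hp (Prod.ext h.1 h.2)), zero_mul]

lemma eq_zero_of_sliceInner_hermiteLp (hI : I ∈ imaginaryUnits) (F : SliceL2 I)
    (h : ∀ m n, sliceInner I (hermiteLp hI m n) F = 0) : F = 0 := by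
  have hF : MemLp (fun z => F (sliceMap hI z)) 2 gaussianC :=
    (Lp.memLp F).comp_measurePreserving (measurePreserving_sliceMap hI)
  have h0 := ae_eq_zero_of_integral_hermiteC_mul hI hF fun m n => by
    rw [← h n m, sliceInner]
    have : ∫ q, star (hermiteLp hI n m q) * F q ∂sliceGaussian I =
        ∫ q : slice I, star (hermiteQ n m (q : ℍ[ℝ])) * F q ∂sliceGaussian I := by
      refine integral_congr_ae ?_
      filter_upwards [coeFn_hermiteLp hI n m] with q hq
      rw [hq]
    rw [this, integral_sliceGaussian hI]
    simp_rw [coe_sliceMap, hermiteQ_embed, star_embed, star_hermiteC]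
  have h1 : ∀ᵐ q ∂gaussianC.map (sliceMap hI), F q = 0 :=
    (measurableEmbedding_sliceMap hI).ae_map_iff.2 h0
  rw [(measurePreserving_sliceMap hI).map_eq] at h1
  exact (Lp.eq_zero_iff_ae_eq_zero).2 h1

/-- The lines spanned by the Hermite polynomials decompose `L²(ℂ_I)`. -/
lemma isHilbertSum_hermiteIsometry (hI : I ∈ imaginaryUnits) :
    IsHilbertSum ℝ (fun _ : ℕ × ℕ => ℍ[ℝ]) (hermiteIsometry hI) := by
  refine IsHilbertSum.mk (orthogonalFamily_hermiteIsometry hI) ?_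
  rw [top_le_iff, Submodule.topologicalClosure_eq_top_iff, Submodule.eq_bot_iff]
  intro F hF
  refine eq_zero_of_sliceInner_hermiteLp hI F fun m n => ?_
  -- pairing `F` with `H_{m,n} K`, where `K = ⟨H_{m,n}, F⟩`, gives `|K|²`
  set K := sliceInner I (hermiteLp hI m n) F with hK
  have h1 : hermiteIsometry hI (m, n) (hermiteNorm m n • K) ∈
      ⨆ p, (hermiteIsometry hI p).range :=
    Submodule.mem_iSup_of_mem (m, n) ⟨_, rfl⟩
  have h2 := hF _ h1
  have h3 := inner_op_smul_op_smul (hermiteLp hI m n) F K 1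
  rw [hermiteIsometry_apply, smul_smul, inv_mul_cancel₀ (hermiteNorm_pos m n).ne', one_smul] at h2
  rw [MulOpposite.op_one, one_smul, h2, star_one, mul_one, ← hK] at h3
  exact inner_self_eq_zero.1 h3.symm

end Transfer

/-! ### The Bargmann spaces as closed subspaces of `L²` -/

section Bargmann

variable {I : ℍ[ℝ]}

lemma orthogonalFamily_level (hI : I ∈ imaginaryUnits) (k : ℕ) :
    OrthogonalFamily ℝ (fun _ : ℕ => ℍ[ℝ]) fun j => hermiteIsometry hI (j, k) :=
  (orthogonalFamily_hermiteIsometry hI).comp (γ := ℕ) (f := fun j => (j, k))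
    fun _ _ h => (Prod.ext_iff.1 h).1

/-- The isometry from `ℓ²(ℕ, ℍ)` into `L²(ℂ_I)` with values in the level `k`. -/
noncomputable def levelIsometry (hI : I ∈ imaginaryUnits) (k : ℕ) :
    lp (fun _ : ℕ => ℍ[ℝ]) 2 →ₗᵢ[ℝ] SliceL2 I :=
  (orthogonalFamily_level hI k).linearIsometry

lemma hasSum_levelIsometry (hI : I ∈ imaginaryUnits) (k : ℕ) (d : lp (fun _ : ℕ => ℍ[ℝ]) 2) :
    HasSum (fun j => hermiteIsometry hI (j, k) (d j)) (levelIsometry hI k d) :=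
  (orthogonalFamily_level hI k).hasSum_linearIsometry d

/-- A series that converges both in `L²` and pointwise has the same sum in both senses: a
subsequence of the `L²` convergent partial sums converges almost everywhere. -/
lemma ae_eq_of_hasSum (hI : I ∈ imaginaryUnits) {k : ℕ} {c : ℕ → ℍ[ℝ]} {F : SliceL2 I}
    {f : ℍ[ℝ] → ℍ[ℝ]} (hF : HasSum (fun j => MulOpposite.op (c j) • hermiteLp hI j k) F)
    (hf : ∀ q, HasSum (fun j => hermiteQ j k q * c j) (f q)) :
    ∀ᵐ q ∂sliceGaussian I, F q = f (q : ℍ[ℝ]) := by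
  obtain ⟨ns, hns, hae⟩ :=
    (tendstoInMeasure_of_tendsto_Lp hF.tendsto_sum_nat).exists_seq_tendsto_ae
  have hpart : ∀ N : ℕ, ∀ᵐ q ∂sliceGaussian I,
      (∑ j ∈ Finset.range N, MulOpposite.op (c j) • hermiteLp hI j k : SliceL2 I) q =
        ∑ j ∈ Finset.range N, hermiteQ j k (q : ℍ[ℝ]) * c j := by
    intro N
    induction N with
    | zero =>
      filter_upwards [Lp.coeFn_zero ℍ[ℝ] 2 (sliceGaussian I)] with q hq
      simpa using hq
    | succ N ih =>
      rw [Finset.sum_range_succ]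
      filter_upwards [ih, Lp.coeFn_add (∑ j ∈ Finset.range N,
        MulOpposite.op (c j) • hermiteLp hI j k : SliceL2 I)
        (MulOpposite.op (c N) • hermiteLp hI N k),
        Lp.coeFn_smul (MulOpposite.op (c N)) (hermiteLp hI N k), coeFn_hermiteLp hI N k]
        with q h1 h2 h3 h4
      rw [Finset.sum_range_succ, h2, Pi.add_apply, h1, h3, Pi.smul_apply, h4, op_smul_eq_mul]
  filter_upwards [hae, ae_all_iff.2 hpart] with q h1 h2
  simp_rw [h2] at h1
  exact tendsto_nhds_unique h1 ((hf q).tendsto_sum_nat.comp hns.tendsto_atTop)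

lemma memℓp_two_iff {d : ℕ → ℍ[ℝ]} :
    Memℓp d 2 ↔ Summable fun j => ‖d j‖ ^ 2 := by
  rw [memℓp_gen_iff (by norm_num)]
  simp

lemma levelIsometry_ae_eq (hI : I ∈ imaginaryUnits) {k : ℕ} {c : ℕ → ℍ[ℝ]}
    {d : lp (fun _ : ℕ => ℍ[ℝ]) 2} (hd : ∀ j, d j = hermiteNorm j k • c j) {f : ℍ[ℝ] → ℍ[ℝ]}
    (hf : ∀ q, HasSum (fun j => hermiteQ j k q * c j) (f q)) :
    ∀ᵐ q ∂sliceGaussian I, levelIsometry hI k d q = f (q : ℍ[ℝ]) := by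
  refine ae_eq_of_hasSum hI ?_ hf
  convert! hasSum_levelIsometry hI k d using 2 with j
  rw [hermiteIsometry_apply, hd, smul_smul, inv_mul_cancel₀ (hermiteNorm_pos j k).ne', one_smul]

/-- The coefficient condition of the Bargmann space, for the coefficients with respect to the
normalised Hermite polynomials. -/
lemma summable_factorial_iff (k : ℕ) (c : ℕ → ℍ[ℝ]) :
    (Summable fun j => (j.factorial : ℝ) * ‖c j‖ ^ 2) ↔
      Memℓp (fun j => hermiteNorm j k • c j) 2 := by
  rw [memℓp_two_iff, ← summable_mul_left_iff (a := Real.pi * k.factorial)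
    (mul_ne_zero Real.pi_ne_zero (by positivity))]
  refine summable_congr fun j => ?_
  rw [norm_smul, mul_pow, Real.norm_eq_abs, sq_abs, sq_hermiteNorm]
  push_cast
  ring

lemma exists_levelIsometry_ae_eq (hI : I ∈ imaginaryUnits) {k : ℕ} {c : ℕ → ℍ[ℝ]}
    (hc : Summable fun j => (j.factorial : ℝ) * ‖c j‖ ^ 2) {f : ℍ[ℝ] → ℍ[ℝ]}
    (hf : ∀ q, HasSum (fun j => hermiteQ j k q * c j) (f q)) :
    ∃ d : lp (fun _ : ℕ => ℍ[ℝ]) 2, (∀ j, d j = hermiteNorm j k • c j) ∧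
      ∀ᵐ q ∂sliceGaussian I, levelIsometry hI k d q = f (q : ℍ[ℝ]) :=
  ⟨⟨_, (summable_factorial_iff k c).1 hc⟩, fun _ => rfl, levelIsometry_ae_eq hI (fun _ => rfl) hf⟩

/-- The level `k` consists exactly of the `L²` convergent series in the lines `H_{j,k} ℍ`. -/
lemma coe_bargmannSlice (hI : I ∈ imaginaryUnits) (k : ℕ) :
    (bargmannSlice I k : Set (SliceL2 I)) = Set.range (levelIsometry hI k) := by
  ext F
  constructor
  · rintro ⟨f, ⟨c, hc, hf⟩, hF⟩
    obtain ⟨d, -, hd⟩ := exists_levelIsometry_ae_eq hI hc hf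
    refine ⟨d, Lp.ext ?_⟩
    filter_upwards [hd, hF] with q h1 h2
    rw [h1, h2]
  · rintro ⟨d, rfl⟩
    set c : ℕ → ℍ[ℝ] := fun j => (hermiteNorm j k)⁻¹ • d j with hc
    have hd : ∀ j, d j = hermiteNorm j k • c j := fun j => by
      rw [hc, smul_smul, mul_inv_cancel₀ (hermiteNorm_pos j k).ne', one_smul]
    have hs : Summable fun j => (j.factorial : ℝ) * ‖c j‖ ^ 2 := by
      rw [summable_factorial_iff k]
      simp_rw [← hd]
      exact lp.memℓp d
    set f : ℍ[ℝ] → ℍ[ℝ] := fun q => ∑' j, hermiteQ j k q * c j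
    have hf : ∀ q, HasSum (fun j => hermiteQ j k q * c j) (f q) :=
      fun q => (summable_hermiteQ_mul k hs q).hasSum
    have hfk : f ∈ bargmann k := ⟨c, hs, hf⟩
    have hae := levelIsometry_ae_eq hI hd hf
    exact ⟨f, hfk, hae⟩

lemma memLp_of_mem_bargmann (hI : I ∈ imaginaryUnits) {k : ℕ} {f : ℍ[ℝ] → ℍ[ℝ]}
    (hf : f ∈ bargmann k) : MemLp (fun q : slice I => f (q : ℍ[ℝ])) 2 (sliceGaussian I) := by
  obtain ⟨c, hc, hf⟩ := hf
  obtain ⟨d, -, hd⟩ := exists_levelIsometry_ae_eq hI hc hf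
  exact (memLp_congr_ae hd).1 (Lp.memLp _)

lemma eq_zero_of_mem_bargmann_of_ae_eq_zero (hI : I ∈ imaginaryUnits) {k : ℕ}
    {f : ℍ[ℝ] → ℍ[ℝ]} (hf : f ∈ bargmann k)
    (h : ∀ᵐ q : slice I ∂sliceGaussian I, f (q : ℍ[ℝ]) = 0) : f = 0 := by
  obtain ⟨c, hc, hf⟩ := hf
  obtain ⟨d, hd, hdf⟩ := exists_levelIsometry_ae_eq hI hc hf
  have h0 : levelIsometry hI k d = 0 := by
    rw [Lp.eq_zero_iff_ae_eq_zero]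
    filter_upwards [hdf, h] with q h1 h2
    rw [h1, h2, Pi.zero_apply]
  have hd0 : d = 0 := (levelIsometry hI k).injective (h0.trans (map_zero _).symm)
  have hc0 : ∀ j, c j = 0 := fun j => by
    have := hd j
    rw [hd0] at this
    exact (smul_eq_zero.1 this.symm).resolve_left (hermiteNorm_pos j k).ne'
  ext1 q
  refine (hf q).unique ?_
  simp [hc0]

lemma inner_eq_zero_of_hasSum {u : ℕ → SliceL2 I} {F G : SliceL2 I} (hF : HasSum u F)
    (h : ∀ j, inner ℝ G (u j) = 0) : inner ℝ G F = 0 := by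
  have h1 := hF.mapL (innerSL ℝ G)
  simp only [innerSL_apply_apply, h] at h1
  exact h1.unique hasSum_zero

lemma inner_eq_zero_of_mem_bargmannSlice (hI : I ∈ imaginaryUnits) {k l : ℕ} (hkl : k ≠ l)
    {F G : SliceL2 I} (hF : F ∈ bargmannSlice I k) (hG : G ∈ bargmannSlice I l) :
    inner ℝ F G = 0 := by
  rw [← SetLike.mem_coe, coe_bargmannSlice hI] at hF hG
  obtain ⟨d, rfl⟩ := hF
  obtain ⟨e, rfl⟩ := hG
  refine inner_eq_zero_of_hasSum (hasSum_levelIsometry hI l e) fun i => ?_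
  rw [real_inner_comm]
  refine inner_eq_zero_of_hasSum (hasSum_levelIsometry hI k d) fun j => ?_
  exact orthogonalFamily_hermiteIsometry hI (by simp [hkl.symm]) _ _

lemma sliceInner_eq_zero_of_mem_bargmannSlice (hI : I ∈ imaginaryUnits) {k l : ℕ} (hkl : k ≠ l)
    {F G : SliceL2 I} (hF : F ∈ bargmannSlice I k) (hG : G ∈ bargmannSlice I l) :
    sliceInner I F G = 0 := by
  -- the real inner product of `F ⟨F, G⟩` and `G` is `|⟨F, G⟩|²`
  have h1 := inner_op_smul_op_smul F G (sliceInner I F G) 1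
  rw [inner_eq_zero_of_mem_bargmannSlice hI hkl (Submodule.smul_mem _ _ hF)
    (Submodule.smul_mem _ _ hG), star_one, mul_one] at h1
  exact inner_self_eq_zero.1 h1.symm

lemma exists_hasSum_bargmannSlice (hI : I ∈ imaginaryUnits) (F : SliceL2 I) :
    ∃ G : ℕ → SliceL2 I, (∀ k, G k ∈ bargmannSlice I k) ∧ HasSum G F := by
  set e := (isHilbertSum_hermiteIsometry hI).linearIsometryEquiv
  set w := e F
  have hw : HasSum (fun p => hermiteIsometry hI p (w p)) F := by
    have := (isHilbertSum_hermiteIsometry hI).hasSum_linearIsometryEquiv_symm w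
    rwa [LinearIsometryEquiv.symm_apply_apply] at this
  have hmem : ∀ k, Memℓp (fun j => w (j, k)) 2 := fun k => by
    have h1 := (memℓp_gen_iff (p := 2) (by norm_num)).1 (lp.memℓp w)
    rw [memℓp_gen_iff (by norm_num)]
    exact h1.comp_injective (i := fun j => (j, k)) fun _ _ h => (Prod.ext_iff.1 h).1
  refine ⟨fun k => levelIsometry hI k ⟨_, hmem k⟩, fun k => ?_, ?_⟩
  · rw [← SetLike.mem_coe, coe_bargmannSlice hI]
    exact ⟨_, rfl⟩
  · exact ((Equiv.prodComm ℕ ℕ).hasSum_iff.2 hw).prod_fiberwise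
      fun k => hasSum_levelIsometry hI k ⟨_, hmem k⟩

lemma eq_of_hasSum_bargmannSlice (hI : I ∈ imaginaryUnits) {F : SliceL2 I}
    {G G' : ℕ → SliceL2 I} (hG : ∀ k, G k ∈ bargmannSlice I k) (hGF : HasSum G F)
    (hG' : ∀ k, G' k ∈ bargmannSlice I k) (hGF' : HasSum G' F) : G = G' := by
  ext1 k
  have hD : ∀ l, (G - G') l ∈ bargmannSlice I l := fun l => sub_mem (hG l) (hG' l)
  have h1 := (hGF.sub hGF').mapL (innerSL ℝ ((G - G') k))
  have h2 : HasSum (fun l => inner ℝ ((G - G') k) ((G - G') l))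
      (inner ℝ ((G - G') k) ((G - G') k)) :=
    hasSum_single k fun l hl => inner_eq_zero_of_mem_bargmannSlice hI hl.symm (hD k) (hD l)
  rw [sub_self, map_zero] at h1
  exact sub_eq_zero.1 (inner_self_eq_zero.1 (h2.unique h1))

lemma isHilbertDirectSum_bargmannSlice (hI : I ∈ imaginaryUnits) :
    IsHilbertDirectSum I (bargmannSlice I) where
  isClosed k := by
    rw [coe_bargmannSlice hI]
    exact (levelIsometry hI k).isometry.isClosedEmbedding.isClosed_range
  orthogonal _ _ hkl _ hF _ hG := sliceInner_eq_zero_of_mem_bargmannSlice hI hkl hF hG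
  existsUnique_hasSum F := by
    obtain ⟨G, hG, hGF⟩ := exists_hasSum_bargmannSlice hI F
    exact ⟨G, ⟨hG, hGF⟩, fun G' h => eq_of_hasSum_bargmannSlice hI h.1 h.2 hG hGF⟩

end Bargmann

end SPolyBargmann

open SPolyBargmann in
theorem mainTheorem5 (I : ℍ[ℝ]) (hI : I ∈ imaginaryUnits) :
    (∀ k : ℕ, ∀ f ∈ bargmann k,
      MemLp (fun q : slice I => f (q : ℍ[ℝ])) 2 (sliceGaussian I)) ∧
    (∀ k : ℕ, ∀ f ∈ bargmann k, ∀ g ∈ bargmann k,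
      (∀ᵐ q : slice I ∂(sliceGaussian I), f (q : ℍ[ℝ]) = g (q : ℍ[ℝ])) → f = g) ∧
    IsHilbertDirectSum I (bargmannSlice I) := by
  refine ⟨fun k f hf => memLp_of_mem_bargmann hI hf, fun k f hf g hg h => ?_,
    isHilbertDirectSum_bargmannSlice hI⟩
  refine sub_eq_zero.1 (eq_zero_of_mem_bargmann_of_ae_eq_zero hI (sub_mem hf hg) ?_)
  filter_upwards [h] with q hq
  rw [Pi.sub_apply, hq, sub_self]
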